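/- Let $X\subset\mathbb R^d$ be a nonempty compact set and, for every $n\ge 1$, let $N_n\ge 2$ be an integer and $\phi_{n,1},\dots,\phi_{n,N_n}:X\to X$ be maps. Suppose that they form a Moran-type iterated function system (MIFS) for the Euclidean metric: there are constants $0<c_{1,n}\le c_{2,n}<1$ with $\lim_{n\to\infty}\prod_{i=1}^n c_{2,i}=0$ such that $$c_{1,n}\|x-y\|\le\|\phi_{n,j}(x)-\phi_{n,j}(y)\|\le c_{2,n}\|x-y\|\qquad(x,y\in X,\ n\ge 1,\ 1\le j\le N_n).$$ Suppose that the MIFS is self-similar: $\phi_{n,j}(x)=r_{n,j}O_{n,j}(x+\alpha_{n,j})$ for $x\in X$, with $r_{n,j}\in(0,1)$, $O_{n,j}$ an orthogonal $d\times d$ matrix and $\alpha_{n,j}\in\mathbb R^d$. Suppose that it satisfies the Moran-type open set condition (MOSC): there are sets $V_n\subseteq X$ $(n\ge1)$, open in $X$, with $\inf_{n\ge 1}\mathcal L^d(V_n)>0$, such that for all $n\ge 1$ $$\phi_{n,j}(V_{n+1})\subseteq V_n\ (1\le j\le N_n),\qquad \phi_{n,i}(V_{n+1})\cap\phi_{n,j}(V_{n+1})=\emptyset\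 (1\le i\ne j\le N_n).$$ Here $\mathcal L^d$ is Lebesgue measure. Suppose that $r_0:=\inf\{r_{n,j}: n\ge1,\ 1\le j\le N_n\}>0$. For $n\ge 1$ let $$K_n=\Big\{\lim_{k\to\infty}\phi_{n,j_n}\circ\phi_{n+1,j_{n+1}}\circ\cdots\circ\phi_{n+k,j_{n+k}}(a)\ :\ 1\le j_i\le N_i \text{ for all } i\ge n\Big\},$$ where $a\in X$ is arbitrary; the limits exist and do not depend on $a$. Let $s\in\mathbb R$, put $P_n(s)=\prod_{i=1}^n\sum_{j=1}^{N_i}r_{i,j}^s$, and suppose that $$0<\liminf_{n\to\infty}P_n(s)\le\limsup_{n\to\infty}P_n(s)<+\infty .$$ Then: (i) All $K_k$ are uniform $s$-sets, that is, $+\infty>\sup_{k\ge 1}\mathcal H^s(K_k)\ge\inf_{k\ge 1}\mathcal H^s(K_k)>0$, where $\mathcal H^s$ is the $s$-dimensional Hausdorff measure. (ii) $\dim_{\rm H}K_n=\underline{\dim}_{\rm B}K_n=\overline{\dim}_{\rm B}K_n=s$ for all $n\ge 1$, where $\dim_{\rm H}$ is the Hausdorff dimension and $\underline{\dim}_{\rm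 B},\overline{\dim}_{\rm B}$ are the lower and upper box-counting dimensions. -/

import Mathlib

open Filter Topology MeasureTheory
open scoped ENNReal NNReal

/-- A Moran-type iterated function system on a compact set `X ⊆ ℝ^d` with the Euclidean metric.
The layers are indexed by `n = 0, 1, 2, …` instead of `n = 1, 2, 3, …`, and the `N n` maps of the
layer `n` by `Fin (N n)`. Only the values of the maps on `X` matter. -/
structure MIFS (d : ℕ) where
  X : Set (EuclideanSpace ℝ (Fin d))
  isCompact_X : IsCompact X
  nonempty_X : X.Nonempty
  N : ℕ → ℕ
  two_le_N : ∀ n, 2 ≤ N n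
  φ : ∀ n, Fin (N n) → EuclideanSpace ℝ (Fin d) → EuclideanSpace ℝ (Fin d)
  mapsTo : ∀ n j, Set.MapsTo (φ n j) X X
  exists_ratios : ∃ c₁ c₂ : ℕ → ℝ,
    (∀ n, 0 < c₁ n ∧ c₁ n ≤ c₂ n ∧ c₂ n < 1) ∧
    Tendsto (fun n => ∏ i ∈ Finset.range n, c₂ i) atTop (𝓝 0) ∧
    ∀ n j, ∀ x ∈ X, ∀ y ∈ X,
      c₁ n * dist x y ≤ dist (φ n j x) (φ n j y) ∧
      dist (φ n j x) (φ n j y) ≤ c₂ n * dist x y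

namespace MIFS

variable {d : ℕ}

/-- `Φ.comp n σ k` is the composition of `k` maps
`φ_{n, σ n} ∘ φ_{n+1, σ (n+1)} ∘ ⋯ ∘ φ_{n+k-1, σ (n+k-1)}`. -/
def comp (Φ : MIFS d) (n : ℕ) (σ : ∀ i, Fin (Φ.N i)) :
    ℕ → EuclideanSpace ℝ (Fin d) → EuclideanSpace ℝ (Fin d)
  | 0 => id
  | k + 1 => comp Φ n σ k ∘ Φ.φ (n + k) (σ (n + k))

/-- The attractor `K_n`: all limits of `φ_{n, σ n} ∘ ⋯ ∘ φ_{n+k-1, σ (n+k-1)} (a)` as `k → ∞`,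
over all infinite words `σ`. Such a limit exists and is the same for all base points `a ∈ X`. -/
def attractor (Φ : MIFS d) (n : ℕ) : Set (EuclideanSpace ℝ (Fin d)) :=
  {x | ∃ σ : ∀ i, Fin (Φ.N i), ∀ a ∈ Φ.X, Tendsto (fun k => Φ.comp n σ k a) atTop (𝓝 x)}

/-- The system is self-similar: `φ_{n,j}(x) = r_{n,j} O_{n,j} (x + α_{n,j})` on `X`, where
`0 < r_{n,j} < 1` and `O_{n,j}` is an orthogonal transformation of `ℝ^d`. -/
def IsSelfSimilar (Φ : MIFS d) (r : ∀ n, Fin (Φ.N n) → ℝ)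
    (O : ∀ n, Fin (Φ.N n) → (EuclideanSpace ℝ (Fin d) ≃ₗᵢ[ℝ] EuclideanSpace ℝ (Fin d)))
    (α : ∀ n, Fin (Φ.N n) → EuclideanSpace ℝ (Fin d)) : Prop :=
  ∀ n j, 0 < r n j ∧ r n j < 1 ∧ ∀ x ∈ Φ.X, Φ.φ n j x = r n j • O n j (x + α n j)

/-- The Moran-type open set condition. The sets `V n ⊆ X` are open in the metric space `X`; this
includes all `V n ⊆ X` that are open in `ℝ^d`. -/
def MOSC (Φ : MIFS d) : Prop :=
  ∃ V : ℕ → Set (EuclideanSpace ℝ (Fin d)),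
    (∀ n, ∃ U, IsOpen U ∧ V n = U ∩ Φ.X) ∧
    (∀ n j, Φ.φ n j '' V (n + 1) ⊆ V n) ∧
    (∀ n i j, i ≠ j → Disjoint (Φ.φ n i '' V (n + 1)) (Φ.φ n j '' V (n + 1))) ∧
    0 < ⨅ n, volume (V n)

end MIFS

/-- `log N_δ(F) / (-log δ)`, where `N_δ(F)` is the smallest number of closed balls of radius `δ`
with centres in `F` that cover `F`. -/
noncomputable def boxQuotient {E : Type*} [PseudoEMetricSpace E] (F : Set E) (δ : ℝ≥0) : EReal :=
  ENNReal.log (Metric.coveringNumber δ F : ℝ≥0∞) / ((-Real.log δ : ℝ) : EReal)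

/-- The lower box-counting dimension. -/
noncomputable def lowerBoxDim {E : Type*} [PseudoEMetricSpace E] (F : Set E) : EReal :=
  liminf (boxQuotient F) (𝓝[>] 0)

/-- The upper box-counting dimension. -/
noncomputable def upperBoxDim {E : Type*} [PseudoEMetricSpace E] (F : Set E) : EReal :=
  limsup (boxQuotient F) (𝓝[>] 0)

/-! Infinite words code the points of the attractors. Give the letter `j` of layer `i` a probability
proportional to `r i j ^ s`. A cylinder of `m` letters from layer `n` on has mass ratio^s divided by
P_{n+m}/P_n, and the hypothesis on P keeps this quotient between positive constants. So mass is
comparable to ratio^s, uniformly in `n`.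

Given a scale `δ`, stop each word when its ratio first drops to `δ` or below; the ratio is then at
least `ρ * δ`, where `ρ` bounds all `r i j` from below. The resulting cylinders have mass of order
δ^s, so there are O(δ^(-s)) of them, and their images have diameter O(δ). This bounds covering
numbers and Hausdorff measure from above. By the open set condition the corresponding copies of `V`
are disjoint with volume of order δ^d, so a ball of radius `δ` meets boundedly many of the images.
The image measure of such a ball is therefore O(δ^s), which gives the lower bounds.

The stopping family is never formed: both estimates are inequalities that pass from the children of
a word to the word itself, and are proved by `word_induction`. -/

/-! ### Covering numbers, Hausdorff measure and box dimension in metric spaces. -/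

theorem coveringNumber_union_le {E : Type*} [PseudoEMetricSpace E] (ε : ℝ≥0) (A B : Set E) :
    Metric.coveringNumber ε (A ∪ B) ≤ Metric.coveringNumber ε A + Metric.coveringNumber ε B := by
  by_cases hA : Metric.coveringNumber ε A = ⊤
  · simp [hA]
  by_cases hB : Metric.coveringNumber ε B = ⊤
  · simp [hB]
  obtain ⟨C, hCA, -, hC, hCc⟩ := Metric.exists_set_encard_eq_coveringNumber hA
  obtain ⟨D, hDB, -, hD, hDc⟩ := Metric.exists_set_encard_eq_coveringNumber hB
  rw [← hCc, ← hDc]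
  refine le_trans (Metric.IsCover.coveringNumber_le_encard (Set.union_subset_union hCA hDB) ?_)
    (Set.encard_union_le C D)
  rintro x (hx | hx)
  · obtain ⟨y, hy, h⟩ := hC hx
    exact ⟨y, Or.inl hy, h⟩
  · obtain ⟨y, hy, h⟩ := hD hx
    exact ⟨y, Or.inr hy, h⟩

theorem coveringNumber_biUnion_le {E ι : Type*} [PseudoEMetricSpace E] (ε : ℝ≥0)
    (t : Finset ι) (A : ι → Set E) :
    Metric.coveringNumber ε (⋃ i ∈ t, A i) ≤ ∑ i ∈ t, Metric.coveringNumber ε (A i) := by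
  classical
  induction t using Finset.induction_on with
  | empty => simp
  | insert i t hi ih =>
    rw [Finset.set_biUnion_insert, Finset.sum_insert hi]
    exact (coveringNumber_union_le _ _ _).trans (by gcongr)

/-- A bound of order `δ ^ (-s)` on covering numbers bounds the `s`-dimensional Hausdorff measure. -/
theorem hausdorffMeasure_le_of_coveringNumber_le {E : Type*} [MetricSpace E] [MeasurableSpace E]
    [BorelSpace E] {K : Set E} {s C : ℝ} {δ₀ : ℝ≥0} (hs : 0 ≤ s) (hC : 0 ≤ C) (hδ₀ : 0 < δ₀)
    (h : ∀ δ : ℝ≥0, 0 < δ → δ < δ₀ →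
      (Metric.coveringNumber δ K : ℝ≥0∞) ≤ ENNReal.ofReal (C * (δ : ℝ) ^ (-s))) :
    μH[s] K ≤ ENNReal.ofReal (C * 2 ^ s) := by
  have hev : ∀ᶠ δ : ℝ≥0 in 𝓝[>] 0, 0 < δ ∧ δ < δ₀ := Ioo_mem_nhdsGT hδ₀
  have hfin : ∀ δ : ℝ≥0, 0 < δ → δ < δ₀ → Metric.coveringNumber δ K ≠ ⊤ := by
    intro δ h1 h2 h3
    have := h δ h1 h2
    simp [h3] at this
  have hT (δ : ℝ≥0) : Finite (Metric.minimalCover δ K) := Metric.finite_minimalCover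
  let _ (δ : ℝ≥0) : Fintype (Metric.minimalCover δ K) := Fintype.ofFinite _
  have key := Measure.hausdorffMeasure_le_liminf_sum (l := 𝓝[>] (0 : ℝ≥0)) s K
    (ι := fun δ => Metric.minimalCover δ K) (r := fun δ => 2 * (δ : ℝ≥0∞)) ?_
    (fun δ x => Metric.closedEBall (x : E) δ) ?_ ?_
  · refine key.trans ?_
    refine liminf_le_of_frequently_le' (Eventually.frequently ?_)
    filter_upwards [hev] with δ hδ
    have hδr : (0 : ℝ) < δ := by exact_mod_cast hδ.1
    calc ∑ i : Metric.minimalCover δ K, Metric.ediam (Metric.closedEBall (i : E) δ) ^ s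
        ≤ ∑ i : Metric.minimalCover δ K, (2 * (δ : ℝ≥0∞)) ^ s := by
          gcongr
          exact Metric.ediam_closedEBall_le
      _ = (Metric.coveringNumber δ K : ℝ≥0∞) * (2 * (δ : ℝ≥0∞)) ^ s := by
          rw [Finset.sum_const, nsmul_eq_mul, Finset.card_univ,
            ← Metric.encard_minimalCover (hfin δ hδ.1 hδ.2),
            ← Metric.finite_minimalCover.cast_ncard_eq, ← Nat.card_eq_fintype_card,
            Nat.card_coe_set_eq, ENat.toENNReal_coe]
      _ ≤ ENNReal.ofReal (C * (δ : ℝ) ^ (-s)) * ENNReal.ofReal ((2 * δ) ^ s) := by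
          gcongr
          · exact h δ hδ.1 hδ.2
          · rw [← ENNReal.ofReal_rpow_of_nonneg (by positivity) hs, ENNReal.ofReal_mul (by norm_num)]
            simp
      _ = ENNReal.ofReal (C * 2 ^ s) := by
          rw [← ENNReal.ofReal_mul (by positivity), Real.mul_rpow (by norm_num) hδr.le,
            Real.rpow_neg hδr.le]
          congr 1
          have : (δ : ℝ) ^ s ≠ 0 := (Real.rpow_pos_of_pos hδr s).ne'
          field_simp
  · have : Tendsto (fun δ : ℝ≥0 => 2 * (δ : ℝ≥0∞)) (𝓝 0) (𝓝 (2 * ((0 : ℝ≥0) : ℝ≥0∞))) :=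
      ENNReal.Tendsto.const_mul (ENNReal.tendsto_coe.2 tendsto_id) (by simp)
    simpa using this.mono_left nhdsWithin_le_nhds
  · exact Eventually.of_forall fun δ i => Metric.ediam_closedEBall_le
  · filter_upwards [hev] with δ hδ
    intro x hx
    obtain ⟨y, hy, hxy⟩ := Metric.isCover_minimalCover (hfin δ hδ.1 hδ.2) hx
    exact Set.mem_iUnion.2 ⟨⟨y, hy⟩, hxy⟩

/-- The mass distribution principle. -/
theorem measure_le_hausdorffMeasure_of_closedBall_le {E : Type*} [MetricSpace E]
    [MeasurableSpace E] [BorelSpace E] {ν : Measure E} {s C : ℝ} {δ₀ : ℝ≥0} (hs : 0 < s)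
    (hC : 0 < C) (hδ₀ : 0 < δ₀)
    (h : ∀ x, ∀ δ : ℝ, 0 < δ → δ < δ₀ → ν (Metric.closedBall x δ) ≤ ENNReal.ofReal (C * δ ^ s)) :
    ν ≤ ENNReal.ofReal C • μH[s] := by
  have hC' : ENNReal.ofReal C ≠ 0 := by simpa using hC
  have key : (ENNReal.ofReal C)⁻¹ • ν ≤ μH[s] := by
    refine Measure.le_hausdorffMeasure s _ (δ₀ / 2 : ℝ≥0) (by positivity) fun S hS => ?_
    rcases S.eq_empty_or_nonempty with rfl | ⟨x, hx⟩
    · simp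
    have hfin : Metric.ediam S ≠ ⊤ := ne_top_of_le_ne_top ENNReal.coe_ne_top hS
    have hd : Metric.diam S < δ₀ := by
      have : Metric.diam S ≤ (δ₀ / 2 : ℝ≥0) := by
        rw [Metric.diam]
        exact ENNReal.toReal_le_coe_of_le_coe hS
      refine this.trans_lt ?_
      exact_mod_cast half_lt_self hδ₀
    have hball : ∀ δ : ℝ, Metric.diam S ≤ δ → S ⊆ Metric.closedBall x δ := fun δ hδ y hy =>
      (Metric.dist_le_diam_of_mem' hfin hy hx).trans hδ
    have hν : ν S ≤ ENNReal.ofReal (C * Metric.diam S ^ s) := by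
      -- The diameter may be zero, where `h` says nothing; so let the radius decrease to it.
      refine ge_of_tendsto (x := 𝓝[>] (Metric.diam S))
        (f := fun δ => ENNReal.ofReal (C * δ ^ s)) ?_ ?_
      · refine (ENNReal.tendsto_ofReal (Tendsto.mono_left ?_ nhdsWithin_le_nhds))
        exact ((Real.continuousAt_rpow_const _ _ (Or.inr hs.le)).tendsto).const_mul C
      · filter_upwards [Ioo_mem_nhdsGT hd] with δ hδ
        exact (measure_mono (hball δ hδ.1.le)).trans
          (h x δ (Metric.diam_nonneg.trans_lt hδ.1) hδ.2)
    rw [Measure.smul_apply, smul_eq_mul]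
    calc (ENNReal.ofReal C)⁻¹ * ν S ≤
        (ENNReal.ofReal C)⁻¹ * (ENNReal.ofReal C * ENNReal.ofReal (Metric.diam S) ^ s) := by
          gcongr
          rwa [ENNReal.ofReal_rpow_of_nonneg Metric.diam_nonneg hs.le, ← ENNReal.ofReal_mul hC.le]
      _ = Metric.ediam S ^ s := by
          rw [← mul_assoc, ENNReal.inv_mul_cancel hC' ENNReal.ofReal_ne_top, one_mul, Metric.diam,
            ENNReal.ofReal_toReal hfin]
  refine Measure.le_iff'.2 fun S => ?_
  have h2 := Measure.le_iff'.1 key S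
  rw [Measure.smul_apply, smul_eq_mul] at h2 ⊢
  calc ν S = ENNReal.ofReal C * ((ENNReal.ofReal C)⁻¹ * ν S) := by
        rw [← mul_assoc, ENNReal.mul_inv_cancel hC' ENNReal.ofReal_ne_top, one_mul]
    _ ≤ _ := by gcongr

/-- A Frostman-type bound on balls gives a lower bound on covering numbers. -/
theorem measure_le_coveringNumber_mul {E : Type*} [MetricSpace E]
    [MeasurableSpace E] {ν : Measure E} {K : Set E} {b : ℝ≥0∞} {δ : ℝ≥0}
    (h : ∀ x, ν (Metric.closedBall x δ) ≤ b) (hfin : Metric.coveringNumber δ K ≠ ⊤) :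
    ν K ≤ (Metric.coveringNumber δ K : ℝ≥0∞) * b := by
  obtain ⟨C, -, hCf, hC, hCc⟩ := Metric.exists_set_encard_eq_coveringNumber hfin
  rw [← hCc]
  have hsub : K ⊆ ⋃ x ∈ hCf.toFinset, Metric.closedBall x δ := by
    intro y hy
    obtain ⟨x, hx, hxy⟩ := hC hy
    refine Set.mem_biUnion (x := x) (by simpa using hx) ?_
    rw [Metric.mem_closedBall, dist_nndist]
    exact_mod_cast (edist_le_coe.1 hxy)
  calc ν K ≤ ∑ x ∈ hCf.toFinset, ν (Metric.closedBall x δ) :=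
        (measure_mono hsub).trans (measure_biUnion_finset_le _ _)
    _ ≤ ∑ x ∈ hCf.toFinset, b := by gcongr; exact h _
    _ = _ := by
      rw [Finset.sum_const, nsmul_eq_mul, hCf.encard_eq_coe_toFinset_card]
      simp

/-- After taking logarithms, the constants contribute only `log c / (-log δ)` and `log C / (-log
δ)`, which vanish in the limit. -/
theorem tendsto_boxQuotient {E : Type*} [PseudoEMetricSpace E] {K : Set E} {s c C : ℝ} {δ₀ : ℝ≥0}
    (hc : 0 < c) (hC : 0 < C) (hδ₀ : 0 < δ₀)
    (hlow : ∀ δ : ℝ≥0, 0 < δ → δ < δ₀ →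
      ENNReal.ofReal (c * (δ : ℝ) ^ (-s)) ≤ (Metric.coveringNumber δ K : ℝ≥0∞))
    (hup : ∀ δ : ℝ≥0, 0 < δ → δ < δ₀ →
      (Metric.coveringNumber δ K : ℝ≥0∞) ≤ ENNReal.ofReal (C * (δ : ℝ) ^ (-s))) :
    Tendsto (boxQuotient K) (𝓝[>] 0) (𝓝 (s : EReal)) := by
  have hcoe : Tendsto (fun δ : ℝ≥0 => (δ : ℝ)) (𝓝[>] 0) (𝓝[>] 0) := by
    refine tendsto_nhdsWithin_iff.2 ⟨?_, ?_⟩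
    · exact (NNReal.continuous_coe.tendsto' 0 0 rfl).mono_left nhdsWithin_le_nhds
    · filter_upwards [self_mem_nhdsWithin] with δ hδ
      exact_mod_cast hδ
  have hlog : Tendsto (fun δ : ℝ≥0 => -Real.log δ) (𝓝[>] 0) atTop :=
    tendsto_neg_atBot_atTop.comp (Real.tendsto_log_nhdsGT_zero.comp hcoe)
  have hlim (a : ℝ) : Tendsto (fun δ : ℝ≥0 => (((Real.log a / (-Real.log δ) + s : ℝ)) : EReal))
      (𝓝[>] 0) (𝓝 (s : EReal)) := by
    refine (continuous_coe_real_ereal.tendsto s).comp ?_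
    simpa using (hlog.const_div_atTop (Real.log a)).add_const s
  have hev : ∀ᶠ δ : ℝ≥0 in 𝓝[>] 0, 0 < δ ∧ δ < min δ₀ 1 := Ioo_mem_nhdsGT (lt_min hδ₀ one_pos)
  have hrw (a : ℝ) (ha : 0 < a) (δ : ℝ≥0) (hδ : 0 < δ) (hδ1 : δ < 1) :
      (((Real.log a / (-Real.log δ) + s : ℝ)) : EReal) =
        ENNReal.log (ENNReal.ofReal (a * (δ : ℝ) ^ (-s))) / ((-Real.log δ : ℝ) : EReal) := by
    have hδr : (0 : ℝ) < δ := by exact_mod_cast hδ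
    have hl : Real.log δ < 0 := Real.log_neg hδr (by exact_mod_cast hδ1)
    rw [ENNReal.log_ofReal_of_pos (by positivity), ← EReal.coe_div,
      Real.log_mul ha.ne' (Real.rpow_pos_of_pos hδr _).ne', Real.log_rpow hδr]
    have hl0 := hl.ne
    congr 1
    field_simp
    ring
  have hnn (δ : ℝ≥0) (hδ : 0 < δ) (hδ1 : δ < 1) : (0 : EReal) ≤ ((-Real.log δ : ℝ) : EReal) := by
    have hδr : (0 : ℝ) < δ := by exact_mod_cast hδ
    have hl : Real.log δ < 0 := Real.log_neg hδr (by exact_mod_cast hδ1)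
    exact_mod_cast (neg_pos.2 hl).le
  refine tendsto_of_tendsto_of_tendsto_of_le_of_le' (hlim c) (hlim C) ?_ ?_
  · filter_upwards [hev] with δ hδ
    obtain ⟨h0, h1⟩ := hδ
    rw [lt_min_iff] at h1
    rw [hrw c hc δ h0 h1.2, boxQuotient]
    exact EReal.div_le_div_right_of_nonneg (hnn δ h0 h1.2) (ENNReal.log_monotone (hlow δ h0 h1.1))
  · filter_upwards [hev] with δ hδ
    obtain ⟨h0, h1⟩ := hδ
    rw [lt_min_iff] at h1
    rw [hrw C hC δ h0 h1.2, boxQuotient]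
    exact EReal.div_le_div_right_of_nonneg (hnn δ h0 h1.2) (ENNReal.log_monotone (hup δ h0 h1.1))

/-! ### Coding of the attractors by words. -/

namespace MIFS

variable {d : ℕ}

theorem comp_congr (Φ : MIFS d) {n m : ℕ} {σ τ : ∀ i, Fin (Φ.N i)}
    (h : ∀ i < m, τ (n + i) = σ (n + i)) : Φ.comp n τ m = Φ.comp n σ m := by
  induction m with
  | zero => rfl
  | succ m ih => simp only [comp, ih fun i hi => h i (hi.trans m.lt_succ_self), h m m.lt_succ_self]

theorem comp_image_subset_of_le (Φ : MIFS d) (n : ℕ) (σ : ∀ i, Fin (Φ.N i)) {k l : ℕ}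
    (h : k ≤ l) : Φ.comp n σ l '' Φ.X ⊆ Φ.comp n σ k '' Φ.X := by
  induction l, h using Nat.le_induction with
  | base => exact subset_rfl
  | succ l _ ih =>
    rw [comp, Set.image_comp]
    exact (Set.image_mono (Φ.mapsTo _ _).image_subset).trans ih

/-- Compositions of `k` maps starting at a given layer contract by factors that tend to zero. -/
theorem exists_comp_contraction (Φ : MIFS d) (n : ℕ) : ∃ c : ℕ → ℝ, Tendsto c atTop (𝓝 0) ∧
    ∀ k (σ : ∀ i, Fin (Φ.N i)), ∀ x ∈ Φ.X, ∀ y ∈ Φ.X,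
      dist (Φ.comp n σ k x) (Φ.comp n σ k y) ≤ c k * dist x y := by
  obtain ⟨c₁, c₂, hc, hlim, hdist⟩ := Φ.exists_ratios
  have hpos : ∀ i, 0 < c₂ i := fun i => (hc i).1.trans_le (hc i).2.1
  refine ⟨fun k => ∏ i ∈ Finset.range k, c₂ (n + i), ?_, fun k => ?_⟩
  · have h0 : ∏ i ∈ Finset.range n, c₂ i ≠ 0 := Finset.prod_ne_zero_iff.2 fun i _ => (hpos i).ne'
    -- The product from layer `n` on is a full product divided by the fixed product of the first `n`
    -- factors.
    have h1 := ((tendsto_add_atTop_iff_nat n).2 hlim).div_const (∏ i ∈ Finset.range n, c₂ i)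
    rw [zero_div] at h1
    refine h1.congr fun k => ?_
    rw [add_comm, Finset.prod_range_add, mul_div_cancel_left₀ _ h0]
  · induction k with
    | zero => intro σ x _ y _; simp [comp]
    | succ k ih =>
      intro σ x hx y hy
      refine (ih σ _ (Φ.mapsTo _ _ hx) _ (Φ.mapsTo _ _ hy)).trans ?_
      dsimp only
      rw [Finset.prod_range_succ, mul_assoc]
      exact mul_le_mul_of_nonneg_left (hdist _ _ _ hx _ hy).2
        (Finset.prod_nonneg fun i _ => (hpos _).le)

theorem exists_dist_le (Φ : MIFS d) : ∃ D : ℝ, 1 ≤ D ∧ ∀ x ∈ Φ.X, ∀ y ∈ Φ.X, dist x y ≤ D :=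
  ⟨max 1 (Metric.diam Φ.X), le_max_left _ _, fun _ hx _ hy =>
    (Metric.dist_le_diam_of_mem Φ.isCompact_X.isBounded hx hy).trans (le_max_right _ _)⟩

/-- The images of `X` under the compositions are nested and their diameters tend to zero. -/
theorem exists_tendsto_comp (Φ : MIFS d) (n : ℕ) (σ : ∀ i, Fin (Φ.N i)) :
    ∃ x, ∀ a ∈ Φ.X, Tendsto (fun k => Φ.comp n σ k a) atTop (𝓝 x) := by
  obtain ⟨c, hc, hdist⟩ := Φ.exists_comp_contraction n
  obtain ⟨D, hD, hXD⟩ := Φ.exists_dist_le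
  obtain ⟨a, ha⟩ := Φ.nonempty_X
  have habs : Tendsto (fun k => |c k| * D) atTop (𝓝 0) := by
    simpa using (hc.abs).mul_const D
  have hle : ∀ k, ∀ x ∈ Φ.X, ∀ y ∈ Φ.X,
      dist (Φ.comp n σ k x) (Φ.comp n σ k y) ≤ |c k| * D := fun k x hx y hy =>
    (hdist k σ x hx y hy).trans
      (mul_le_mul (le_abs_self _) (hXD x hx y hy) dist_nonneg (abs_nonneg _))
  have hcauchy : CauchySeq fun k => Φ.comp n σ k a := by
    refine cauchySeq_of_le_tendsto_0' (fun k => |c k| * D) (fun k l hkl => ?_) habs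
    obtain ⟨b, hb, hbe⟩ := Φ.comp_image_subset_of_le n σ hkl ⟨a, ha, rfl⟩
    rw [← hbe]
    exact hle k a ha b hb
  obtain ⟨x, hx⟩ := cauchySeq_tendsto_of_complete hcauchy
  refine ⟨x, fun b hb => ?_⟩
  refine hx.congr_dist (squeeze_zero (fun _ => dist_nonneg) (fun k => hle k a ha b hb) habs)

/-- The point of the attractor `K_n` with the address `σ`. -/
noncomputable def point (Φ : MIFS d) (n : ℕ) (σ : ∀ i, Fin (Φ.N i)) : EuclideanSpace ℝ (Fin d) :=
  (Φ.exists_tendsto_comp n σ).choose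

theorem tendsto_comp_point (Φ : MIFS d) (n : ℕ) (σ : ∀ i, Fin (Φ.N i)) {a} (ha : a ∈ Φ.X) :
    Tendsto (fun k => Φ.comp n σ k a) atTop (𝓝 (Φ.point n σ)) :=
  (Φ.exists_tendsto_comp n σ).choose_spec a ha

theorem attractor_eq_range_point (Φ : MIFS d) (n : ℕ) :
    Φ.attractor n = Set.range (Φ.point n) := by
  obtain ⟨a, ha⟩ := Φ.nonempty_X
  ext x
  constructor
  · rintro ⟨σ, hσ⟩
    exact ⟨σ, tendsto_nhds_unique (Φ.tendsto_comp_point n σ ha) (hσ a ha)⟩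
  · rintro ⟨σ, rfl⟩
    exact ⟨σ, fun a ha => Φ.tendsto_comp_point n σ ha⟩

/-- The maps need not be measurable: each letter has finitely many values, and for a fixed last
letter the inner point is fixed. Hence the induction over all `x`. -/
theorem measurable_comp (Φ : MIFS d) (n k : ℕ) (x : EuclideanSpace ℝ (Fin d)) :
    Measurable fun σ => Φ.comp n σ k x := by
  induction k generalizing x with
  | zero => exact measurable_const
  | succ k ih =>
    have h : Measurable fun p : (∀ i, Fin (Φ.N i)) × Fin (Φ.N (n + k)) =>
        Φ.comp n p.1 k (Φ.φ (n + k) p.2 x) :=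
      measurable_from_prod_countable_left fun j => ih (Φ.φ (n + k) j x)
    exact h.comp (measurable_id.prodMk (measurable_pi_apply (n + k)))

theorem measurable_point (Φ : MIFS d) (n : ℕ) : Measurable (Φ.point n) := by
  obtain ⟨a, ha⟩ := Φ.nonempty_X
  exact measurable_of_tendsto_metrizable (fun k => Φ.measurable_comp n k a)
    (tendsto_pi_nhds.2 fun σ => Φ.tendsto_comp_point n σ ha)

/-- The words that agree with `σ` in the `m` places `n, …, n + m - 1`. -/
def cylinder (Φ : MIFS d) (n : ℕ) (σ : ∀ i, Fin (Φ.N i)) (m : ℕ) : Set (∀ i, Fin (Φ.N i)) :=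
  {τ | ∀ i < m, τ (n + i) = σ (n + i)}

/-- A finite word is represented by an infinite `σ` and a length `m`; its children arise by updating
the letter at `n + m`. -/
theorem cylinder_subset_iUnion_update (Φ : MIFS d) (n : ℕ) (σ : ∀ i, Fin (Φ.N i)) (m : ℕ) :
    Φ.cylinder n σ m ⊆ ⋃ j, Φ.cylinder n (Function.update σ (n + m) j) (m + 1) := by
  intro τ hτ
  refine Set.mem_iUnion.2 ⟨τ (n + m), fun i hi => ?_⟩
  rcases Nat.lt_succ_iff_lt_or_eq.1 hi with h | rfl
  · rw [Function.update_of_ne (by omega), hτ i h]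
  · simp

theorem comp_update (Φ : MIFS d) (n : ℕ) (σ : ∀ i, Fin (Φ.N i)) (m : ℕ) (j : Fin (Φ.N (n + m))) :
    Φ.comp n (Function.update σ (n + m) j) (m + 1) = Φ.comp n σ m ∘ Φ.φ (n + m) j := by
  rw [comp, Φ.comp_congr (σ := σ) fun i hi => Function.update_of_ne (by omega) _ _,
    Function.update_self]

/-- The contraction ratio of `Φ.comp n σ m`. -/
def ratio (Φ : MIFS d) (r : ∀ n, Fin (Φ.N n) → ℝ) (n : ℕ) (σ : ∀ i, Fin (Φ.N i)) (m : ℕ) : ℝ :=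
  ∏ i ∈ Finset.range m, r (n + i) (σ (n + i))

theorem ratio_update (Φ : MIFS d) (r : ∀ n, Fin (Φ.N n) → ℝ) (n : ℕ) (σ : ∀ i, Fin (Φ.N i))
    (m : ℕ) (j : Fin (Φ.N (n + m))) :
    Φ.ratio r n (Function.update σ (n + m) j) (m + 1) = Φ.ratio r n σ m * r (n + m) j := by
  rw [ratio, Finset.prod_range_succ, Function.update_self, ratio]
  congr 1
  refine Finset.prod_congr rfl fun i hi => ?_
  rw [Function.update_of_ne (by have := Finset.mem_range.1 hi; omega)]

/-! ### Geometry of self-similar compositions. -/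

section SelfSimilar

variable {Φ : MIFS d} {r : ∀ n, Fin (Φ.N n) → ℝ}
  {O : ∀ n, Fin (Φ.N n) → (EuclideanSpace ℝ (Fin d) ≃ₗᵢ[ℝ] EuclideanSpace ℝ (Fin d))}
  {α : ∀ n, Fin (Φ.N n) → EuclideanSpace ℝ (Fin d)}

theorem IsSelfSimilar.ratio_pos (hΦ : Φ.IsSelfSimilar r O α) (n : ℕ) (σ : ∀ i, Fin (Φ.N i))
    (m : ℕ) : 0 < Φ.ratio r n σ m :=
  Finset.prod_pos fun _ _ => (hΦ _ _).1

theorem IsSelfSimilar.dist_comp (hΦ : Φ.IsSelfSimilar r O α) (n : ℕ) (σ : ∀ i, Fin (Φ.N i))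
    (m : ℕ) {x y} (hx : x ∈ Φ.X) (hy : y ∈ Φ.X) :
    dist (Φ.comp n σ m x) (Φ.comp n σ m y) = Φ.ratio r n σ m * dist x y := by
  induction m generalizing x y with
  | zero => simp [comp, ratio]
  | succ m ih =>
    obtain ⟨h0, -, h⟩ := hΦ (n + m) (σ (n + m))
    rw [comp, Function.comp, Function.comp, ih (Φ.mapsTo _ _ hx) (Φ.mapsTo _ _ hy), h x hx, h y hy,
      dist_smul₀, LinearIsometryEquiv.dist_map, dist_add_right, ratio, ratio,
      Finset.prod_range_succ, Real.norm_of_nonneg h0.le, mul_assoc]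

theorem IsSelfSimilar.injOn_comp (hΦ : Φ.IsSelfSimilar r O α) (n : ℕ) (σ : ∀ i, Fin (Φ.N i))
    (m : ℕ) : Set.InjOn (Φ.comp n σ m) Φ.X := fun x hx y hy h => by
  have := hΦ.dist_comp n σ m hx hy
  rw [h, dist_self] at this
  exact dist_eq_zero.1 ((mul_eq_zero.1 this.symm).resolve_left (hΦ.ratio_pos n σ m).ne')

theorem IsSelfSimilar.continuousOn_comp (hΦ : Φ.IsSelfSimilar r O α) (n : ℕ)
    (σ : ∀ i, Fin (Φ.N i)) (m : ℕ) : ContinuousOn (Φ.comp n σ m) Φ.X :=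
  (LipschitzOnWith.of_dist_le_mul (K := ⟨_, (hΦ.ratio_pos n σ m).le⟩) fun _ hx _ hy =>
    (hΦ.dist_comp n σ m hx hy).le).continuousOn

open scoped Pointwise in
theorem IsSelfSimilar.volume_comp_image (hΦ : Φ.IsSelfSimilar r O α) (n : ℕ)
    (σ : ∀ i, Fin (Φ.N i)) (m : ℕ) {S : Set (EuclideanSpace ℝ (Fin d))} (hS : S ⊆ Φ.X) :
    volume (Φ.comp n σ m '' S) = ENNReal.ofReal (Φ.ratio r n σ m ^ d) * volume S := by
  induction m generalizing S with
  | zero => simp [comp, ratio]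
  | succ m ih =>
    obtain ⟨h0, -, h⟩ := hΦ (n + m) (σ (n + m))
    have himg : Φ.φ (n + m) (σ (n + m)) '' S =
        r (n + m) (σ (n + m)) • (O (n + m) (σ (n + m)) '' ((fun x => x + α (n + m) (σ (n + m))) '' S)) := by
      rw [Set.image_image, ← Set.image_smul, Set.image_image]
      exact Set.image_congr fun x hx => h x (hS hx)
    have hO : ∀ T, volume (O (n + m) (σ (n + m)) '' T) = volume T := fun T => by
      rw [← (O (n + m) (σ (n + m))).symm.measurePreserving.measure_preimage_equiv
        (f := (O (n + m) (σ (n + m))).symm.toMeasurableEquiv) T]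
      congr 1
      exact (O (n + m) (σ (n + m))).toEquiv.image_eq_preimage_symm T
    rw [comp, Set.image_comp, ih ((Set.image_mono hS).trans (Φ.mapsTo _ _).image_subset), himg,
      Measure.addHaar_smul, hO, Set.image_add_right, measure_preimage_add_right, ← mul_assoc,
      finrank_euclideanSpace_fin, abs_of_nonneg (by positivity),
      ← ENNReal.ofReal_mul (by have := (hΦ.ratio_pos n σ m).le; positivity), ← mul_pow]
    simp only [ratio, Finset.prod_range_succ]

/-- A point with an address in a cylinder is close to the corresponding copy of `X`. -/
theorem IsSelfSimilar.dist_point_comp_le (hΦ : Φ.IsSelfSimilar r O α) {D : ℝ}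
    (hD : ∀ x ∈ Φ.X, ∀ y ∈ Φ.X, dist x y ≤ D) {n m : ℕ} {σ τ : ∀ i, Fin (Φ.N i)}
    (hτ : τ ∈ Φ.cylinder n σ m) {y} (hy : y ∈ Φ.X) :
    dist (Φ.point n τ) (Φ.comp n σ m y) ≤ Φ.ratio r n σ m * D := by
  refine le_of_tendsto ((Φ.tendsto_comp_point n τ hy).dist tendsto_const_nhds) ?_
  filter_upwards [eventually_ge_atTop m] with k hk
  obtain ⟨b, hb, hbe⟩ := Φ.comp_image_subset_of_le n τ hk ⟨y, hy, rfl⟩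
  rw [← hbe, Φ.comp_congr hτ, hΦ.dist_comp n σ m hb hy]
  exact mul_le_mul_of_nonneg_left (hD b hb y hy) (hΦ.ratio_pos n σ m).le

/-- Let the second point in `dist_point_comp_le` run through the iterates along `τ'`; this avoids
the factor 2 of the triangle inequality. -/
theorem IsSelfSimilar.dist_point_le (hΦ : Φ.IsSelfSimilar r O α) {D : ℝ}
    (hD : ∀ x ∈ Φ.X, ∀ y ∈ Φ.X, dist x y ≤ D) {n m : ℕ} {σ τ τ' : ∀ i, Fin (Φ.N i)}
    (hτ : τ ∈ Φ.cylinder n σ m) (hτ' : τ' ∈ Φ.cylinder n σ m) :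
    dist (Φ.point n τ) (Φ.point n τ') ≤ Φ.ratio r n σ m * D := by
  obtain ⟨y, hy⟩ := Φ.nonempty_X
  refine le_of_tendsto (tendsto_const_nhds.dist (Φ.tendsto_comp_point n τ' hy)) ?_
  filter_upwards [eventually_ge_atTop m] with k hk
  obtain ⟨b, hb, hbe⟩ := Φ.comp_image_subset_of_le n τ' hk ⟨y, hy, rfl⟩
  rw [← hbe, Φ.comp_congr hτ']
  exact hΦ.dist_point_comp_le hD hτ hb

/-- If `X` has two points, then the ratios of long words are uniformly small. -/
theorem IsSelfSimilar.exists_ratio_le (hΦ : Φ.IsSelfSimilar r O α) (hX : Φ.X.Nontrivial) (n : ℕ)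
    {δ : ℝ} (hδ : 0 < δ) : ∃ L, ∀ m ≥ L, ∀ σ, Φ.ratio r n σ m ≤ δ := by
  obtain ⟨c, hc, hdist⟩ := Φ.exists_comp_contraction n
  obtain ⟨x, hx, y, hy, hxy⟩ := hX
  obtain ⟨L, hL⟩ := eventually_atTop.1 (hc.eventually_le_const hδ)
  refine ⟨L, fun m hm σ => le_trans ?_ (hL m hm)⟩
  have := hdist m σ x hx y hy
  rw [hΦ.dist_comp n σ m hx hy] at this
  exact le_of_mul_le_mul_right this (dist_pos.2 hxy)

/-- Induction over the tree of words, from the words with ratio comparable to `δ` to the root. -/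
theorem IsSelfSimilar.word_induction (hΦ : Φ.IsSelfSimilar r O α) (hX : Φ.X.Nontrivial) (n : ℕ)
    {ρ δ : ℝ} (hρ : ∀ n j, ρ ≤ r n j) (hδ : 0 < δ) {Q : (∀ i, Fin (Φ.N i)) → ℕ → Prop}
    (base : ∀ σ m, Φ.ratio r n σ m ≤ δ → ρ * δ ≤ Φ.ratio r n σ m → Q σ m)
    (step : ∀ σ m, (∀ j, Q (Function.update σ (n + m) j) (m + 1)) → Q σ m)
    (σ : ∀ i, Fin (Φ.N i)) (m : ℕ) (h : ρ * δ ≤ Φ.ratio r n σ m) : Q σ m := by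
  obtain ⟨L, hL⟩ := hΦ.exists_ratio_le hX n hδ
  -- `t` bounds the number of letters missing to length `L`, where the ratio is surely at most `δ`.
  -- A word with ratio above `δ` has children with ratio at least `ρ * δ`, so no branch jumps over
  -- the base case.
  have key : ∀ t σ m, L ≤ m + t → ρ * δ ≤ Φ.ratio r n σ m → Q σ m := by
    intro t
    induction t with
    | zero => exact fun σ m hm h => base σ m (hL m hm σ) h
    | succ t ih =>
      intro σ m hm h
      rcases le_or_gt (Φ.ratio r n σ m) δ with hle | hgt
      · exact base σ m hle h
      · refine step σ m fun j => ih _ _ (by omega) ?_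
        rw [ratio_update, mul_comm ρ]
        exact (mul_le_mul_of_nonneg_left (hρ _ j) hδ.le).trans
          (mul_le_mul_of_nonneg_right hgt.le (hΦ _ _).1.le)
  exact key L σ m (by omega) h

end SelfSimilar

end MIFS

/-! ### The measure on words and the two tree estimates. -/

namespace MIFS

variable {d : ℕ} {Φ : MIFS d}

theorem measurableSet_cylinder (n : ℕ) (σ : ∀ i, Fin (Φ.N i)) (m : ℕ) :
    MeasurableSet (Φ.cylinder n σ m) := by
  have : Φ.cylinder n σ m = ⋂ i, ⋂ (_ : i < m), (fun τ => τ (n + i)) ⁻¹' {σ (n + i)} := by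
    ext τ
    simp [cylinder]
  rw [this]
  exact MeasurableSet.iInter fun i => MeasurableSet.iInter fun _ =>
    measurable_pi_apply (n + i) (measurableSet_singleton _)

theorem sum_measure_cylinder_update_le (μ : Measure (∀ i, Fin (Φ.N i))) (n : ℕ)
    (σ : ∀ i, Fin (Φ.N i)) (m : ℕ) :
    ∑ j, μ (Φ.cylinder n (Function.update σ (n + m) j) (m + 1)) ≤ μ (Φ.cylinder n σ m) := by
  rw [← tsum_fintype (L := .unconditional _), ← measure_iUnion]
  · refine measure_mono (Set.iUnion_subset fun j τ hτ i hi => ?_)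
    rw [hτ i (by omega), Function.update_of_ne (by omega)]
  · intro i j hij
    refine Set.disjoint_left.2 fun τ h1 h2 => hij ?_
    have h1 := h1 m m.lt_succ_self
    have h2 := h2 m m.lt_succ_self
    rw [Function.update_self] at h1 h2
    rw [← h1, ← h2]
  · exact fun j => measurableSet_cylinder _ _ _

/-- The product measure on words for which the letter `j` of the layer `i` has probability
`r i j ^ s / ∑ l, r i l ^ s`. -/
theorem exists_wordMeasure {r : ∀ n, Fin (Φ.N n) → ℝ} (hr : ∀ n j, 0 < r n j) (s : ℝ) :
    ∃ μ : Measure (∀ i, Fin (Φ.N i)), IsProbabilityMeasure μ ∧ ∀ n σ m,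
      μ (Φ.cylinder n σ m) = ENNReal.ofReal (Φ.ratio r n σ m ^ s /
        ∏ i ∈ Finset.range m, ∑ j, r (n + i) j ^ s) := by
  have hS : ∀ i, 0 < ∑ j, r i j ^ s := fun i =>
    Finset.sum_pos (fun j _ => Real.rpow_pos_of_pos (hr i j) s)
      ⟨⟨0, two_pos.trans_le (Φ.two_le_N i)⟩, Finset.mem_univ _⟩
  let p (i : ℕ) : Measure (Fin (Φ.N i)) :=
    ∑ j, ENNReal.ofReal (r i j ^ s / ∑ l, r i l ^ s) • Measure.dirac j
  have hp1 (i : ℕ) (j : Fin (Φ.N i)) : p i {j} = ENNReal.ofReal (r i j ^ s / ∑ l, r i l ^ s) := by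
    simp only [p, Measure.coe_finsetSum, Finset.sum_apply, Measure.smul_apply, smul_eq_mul]
    rw [Finset.sum_eq_single j]
    · simp
    · intro l _ hl
      simp [hl]
    · simp
  have hp (i : ℕ) : IsProbabilityMeasure (p i) := by
    constructor
    simp only [p, Measure.coe_finsetSum, Finset.sum_apply, Measure.smul_apply, smul_eq_mul,
      measure_univ, mul_one]
    rw [← ENNReal.ofReal_sum_of_nonneg
      (fun j _ => div_nonneg (Real.rpow_nonneg (hr i j).le s) (hS i).le), ← Finset.sum_div,
      div_self (hS i).ne', ENNReal.ofReal_one]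
  refine ⟨Measure.infinitePi p, inferInstance, fun n σ m => ?_⟩
  have hcyl : Φ.cylinder n σ m =
      Set.pi (Finset.image (fun i => n + i) (Finset.range m) : Finset ℕ) fun i => {σ i} := by
    ext τ
    simp [cylinder, Set.mem_pi]
  rw [hcyl, Measure.infinitePi_pi _ fun i _ => measurableSet_singleton _,
    Finset.prod_image (by intro i _ j _ h; simpa using h)]
  simp only [hp1]
  rw [← ENNReal.ofReal_prod_of_nonneg
    fun i _ => div_nonneg (Real.rpow_nonneg (hr _ _).le s) (hS _).le, Finset.prod_div_distrib,
    ratio, Real.finsetProd_rpow _ _ fun i _ => (hr _ _).le]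

variable {r : ∀ n, Fin (Φ.N n) → ℝ}
  {O : ∀ n, Fin (Φ.N n) → (EuclideanSpace ℝ (Fin d) ≃ₗᵢ[ℝ] EuclideanSpace ℝ (Fin d))}
  {α : ∀ n, Fin (Φ.N n) → EuclideanSpace ℝ (Fin d)}

/-- At a stopped word one ball suffices, and the right side is at least 1 because the mass is at
least `(ρ * δ) ^ s / b`. Towards the root, covering numbers are subadditive and the masses of
sibling cylinders add up. -/
theorem IsSelfSimilar.coveringNumber_point_image_cylinder_le (hΦ : Φ.IsSelfSimilar r O α)
    (hX : Φ.X.Nontrivial) {D : ℝ≥0} (hD : ∀ x ∈ Φ.X, ∀ y ∈ Φ.X, dist x y ≤ D) {ρ b s : ℝ}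
    (hρ0 : 0 < ρ) (hρ : ∀ n j, ρ ≤ r n j) (hb : 0 < b) (hs : 0 ≤ s)
    {μ : Measure (∀ i, Fin (Φ.N i))}
    (hμ : ∀ n σ m, ENNReal.ofReal (Φ.ratio r n σ m ^ s / b) ≤ μ (Φ.cylinder n σ m))
    (n : ℕ) {δ : ℝ≥0} (hδ : 0 < δ) (σ : ∀ i, Fin (Φ.N i)) (m : ℕ)
    (h : ρ * δ ≤ Φ.ratio r n σ m) :
    (Metric.coveringNumber (δ * D) (Φ.point n '' Φ.cylinder n σ m) : ℝ≥0∞) ≤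
      ENNReal.ofReal (b * (ρ * δ) ^ (-s)) * μ (Φ.cylinder n σ m) := by
  have hδ' : (0 : ℝ) < δ := hδ
  have hρδ : 0 < ρ * δ := by positivity
  refine hΦ.word_induction hX n hρ hδ' (Q := fun σ m =>
    (Metric.coveringNumber (δ * D) (Φ.point n '' Φ.cylinder n σ m) : ℝ≥0∞) ≤
      ENNReal.ofReal (b * (ρ * δ) ^ (-s)) * μ (Φ.cylinder n σ m)) ?_ ?_ σ m h
  · intro σ m hle hge
    calc (Metric.coveringNumber (δ * D) (Φ.point n '' Φ.cylinder n σ m) : ℝ≥0∞) ≤ (1 : ℕ∞) := by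
          refine ENat.toENNReal_mono (Metric.coveringNumber_le_one_of_ediam_le ?_)
          refine Metric.ediam_le ?_
          rintro _ ⟨τ, hτ, rfl⟩ _ ⟨τ', hτ', rfl⟩
          rw [edist_dist]
          refine ENNReal.ofReal_le_of_le_toReal ?_
          rw [ENNReal.coe_toReal, NNReal.coe_mul]
          exact (hΦ.dist_point_le hD hτ hτ').trans (by gcongr)
      _ = ENNReal.ofReal (b * (ρ * δ) ^ (-s)) * ENNReal.ofReal ((ρ * δ) ^ s / b) := by
          rw [← ENNReal.ofReal_mul (by positivity), Real.rpow_neg hρδ.le]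
          have := (Real.rpow_pos_of_pos hρδ s).ne'
          field_simp
          simp
      _ ≤ _ := by
          gcongr
          refine le_trans ?_ (hμ n σ m)
          gcongr
  · intro σ m ih
    calc (Metric.coveringNumber (δ * D) (Φ.point n '' Φ.cylinder n σ m) : ℝ≥0∞)
        ≤ ((∑ j, Metric.coveringNumber (δ * D)
            (Φ.point n '' Φ.cylinder n (Function.update σ (n + m) j) (m + 1)) : ℕ∞) : ℝ≥0∞) := by
          refine ENat.toENNReal_mono (le_trans (le_of_eq ?_) (coveringNumber_biUnion_le _ _ _))
          congr 1
          rw [← Set.image_iUnion₂]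
          refine congrArg _ (Set.Subset.antisymm ?_ ?_)
          · simpa using Φ.cylinder_subset_iUnion_update n σ m
          · refine Set.iUnion₂_subset fun j _ τ hτ i hi => ?_
            rw [hτ i (by omega), Function.update_of_ne (by omega)]
      _ = ∑ j, (Metric.coveringNumber (δ * D)
            (Φ.point n '' Φ.cylinder n (Function.update σ (n + m) j) (m + 1)) : ℝ≥0∞) := by
          exact map_sum ENat.toENNRealRingHom _ _
      _ ≤ ∑ j, ENNReal.ofReal (b * (ρ * δ) ^ (-s)) *
            μ (Φ.cylinder n (Function.update σ (n + m) j) (m + 1)) :=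
          Finset.sum_le_sum fun j _ => ih j
      _ ≤ _ := by
          rw [← Finset.mul_sum]
          gcongr
          exact sum_measure_cylinder_update_le μ n σ m

/-- Mass is compared with volume: the constant is the largest mass `δ ^ s / a` of a stopped word
over the least volume `(ρ * δ) ^ d * v` of its copy of `V`. Disjointness of the copies carries the
comparison to the parent. -/
theorem IsSelfSimilar.measure_cylinder_inter_preimage_closedBall_le (hΦ : Φ.IsSelfSimilar r O α)
    (hX : Φ.X.Nontrivial) {D : ℝ} (hD0 : 0 ≤ D) (hD : ∀ x ∈ Φ.X, ∀ y ∈ Φ.X, dist x y ≤ D)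
    {ρ a v s : ℝ} (hρ0 : 0 < ρ) (hρ : ∀ n j, ρ ≤ r n j) (ha : 0 < a) (hv : 0 < v) (hs : 0 ≤ s)
    {V : ℕ → Set (EuclideanSpace ℝ (Fin d))} (hVX : ∀ n, V n ⊆ Φ.X)
    (hVm : ∀ n, MeasurableSet (V n)) (hVφ : ∀ n j, Φ.φ n j '' V (n + 1) ⊆ V n)
    (hVd : ∀ n i j, i ≠ j → Disjoint (Φ.φ n i '' V (n + 1)) (Φ.φ n j '' V (n + 1)))
    (hVv : ∀ n, ENNReal.ofReal v ≤ volume (V n))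
    {μ : Measure (∀ i, Fin (Φ.N i))}
    (hμ : ∀ n σ m, μ (Φ.cylinder n σ m) ≤ ENNReal.ofReal (Φ.ratio r n σ m ^ s / a))
    (n : ℕ) (x : EuclideanSpace ℝ (Fin d)) {δ : ℝ} (hδ : 0 < δ) (σ : ∀ i, Fin (Φ.N i)) (m : ℕ)
    (h : ρ * δ ≤ Φ.ratio r n σ m) :
    μ (Φ.cylinder n σ m ∩ Φ.point n ⁻¹' Metric.closedBall x δ) ≤
      ENNReal.ofReal (δ ^ s / (a * ((ρ * δ) ^ d * v))) *
        volume (Φ.comp n σ m '' V (n + m) ∩ Metric.closedBall x (δ * (1 + D))) := by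
  refine hΦ.word_induction hX n hρ hδ (Q := fun σ m =>
    μ (Φ.cylinder n σ m ∩ Φ.point n ⁻¹' Metric.closedBall x δ) ≤
      ENNReal.ofReal (δ ^ s / (a * ((ρ * δ) ^ d * v))) *
        volume (Φ.comp n σ m '' V (n + m) ∩ Metric.closedBall x (δ * (1 + D)))) ?_ ?_ σ m h
  · intro σ m hle hge
    have hr0 := hΦ.ratio_pos n σ m
    rcases (Φ.cylinder n σ m ∩ Φ.point n ⁻¹' Metric.closedBall x δ).eq_empty_or_nonempty with
      he | ⟨τ, hτ, hτx⟩
    · simp [he]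
    -- One coded point in the small ball pulls the whole copy of `V` into the enlarged ball.
    have hsub : Φ.comp n σ m '' V (n + m) ⊆ Metric.closedBall x (δ * (1 + D)) := by
      rintro _ ⟨y, hy, rfl⟩
      rw [Metric.mem_closedBall]
      have h1 := hΦ.dist_point_comp_le hD hτ (hVX _ hy)
      have h2 : dist (Φ.point n τ) x ≤ δ := hτx
      have h3 := dist_triangle_left (Φ.comp n σ m y) x (Φ.point n τ)
      have h4 : Φ.ratio r n σ m * D ≤ δ * D := by gcongr
      linarith
    rw [Set.inter_eq_left.2 hsub, hΦ.volume_comp_image n σ m (hVX _)]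
    calc μ (Φ.cylinder n σ m ∩ Φ.point n ⁻¹' Metric.closedBall x δ)
        ≤ μ (Φ.cylinder n σ m) := measure_mono Set.inter_subset_left
      _ ≤ ENNReal.ofReal (Φ.ratio r n σ m ^ s / a) := hμ n σ m
      _ ≤ ENNReal.ofReal (δ ^ s / a) := by gcongr
      _ = ENNReal.ofReal (δ ^ s / (a * ((ρ * δ) ^ d * v))) *
            (ENNReal.ofReal ((ρ * δ) ^ d) * ENNReal.ofReal v) := by
          rw [← ENNReal.ofReal_mul (by positivity), ← ENNReal.ofReal_mul (by positivity)]
          congr 1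
          field_simp
      _ ≤ _ := by
          gcongr
          exact hVv _
  · intro σ m ih
    have himg (j) : Φ.comp n (Function.update σ (n + m) j) (m + 1) '' V (n + (m + 1)) =
        Φ.comp n σ m '' (Φ.φ (n + m) j '' V (n + m + 1)) := by
      rw [comp_update, Set.image_comp, add_assoc]
    -- Lusin–Souslin: continuous injective images of Borel sets are Borel.
    have hmeas (j) : MeasurableSet (Φ.comp n (Function.update σ (n + m) j) (m + 1) ''
        V (n + (m + 1))) :=
      (hVm _).image_of_continuousOn_injOn ((hΦ.continuousOn_comp n _ _).mono (hVX _))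
        ((hΦ.injOn_comp n _ _).mono (hVX _))
    calc μ (Φ.cylinder n σ m ∩ Φ.point n ⁻¹' Metric.closedBall x δ)
        ≤ μ (⋃ j, (Φ.cylinder n (Function.update σ (n + m) j) (m + 1) ∩
            Φ.point n ⁻¹' Metric.closedBall x δ)) := by
          rw [← Set.iUnion_inter]
          exact measure_mono (Set.inter_subset_inter_left _ (Φ.cylinder_subset_iUnion_update n σ m))
      _ ≤ ∑ j, μ (Φ.cylinder n (Function.update σ (n + m) j) (m + 1) ∩
            Φ.point n ⁻¹' Metric.closedBall x δ) := measure_iUnion_fintype_le _ _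
      _ ≤ _ := Finset.sum_le_sum fun j _ => ih j
      _ = ENNReal.ofReal (δ ^ s / (a * ((ρ * δ) ^ d * v))) *
            volume (⋃ j, Φ.comp n (Function.update σ (n + m) j) (m + 1) '' V (n + (m + 1)) ∩
              Metric.closedBall x (δ * (1 + D))) := by
          rw [← Finset.mul_sum, measure_iUnion, tsum_fintype]
          · intro i j hij
            refine Disjoint.mono Set.inter_subset_left Set.inter_subset_left ?_
            rw [himg, himg]
            refine Set.disjoint_image_image fun y hy z hz hyz => ?_
            have := hΦ.injOn_comp n σ m (hVX _ (hVφ _ _ hy)) (hVX _ (hVφ _ _ hz)) hyz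
            exact Set.disjoint_left.1 (hVd _ _ _ hij) hy (this ▸ hz)
          · exact fun j => (hmeas j).inter Metric.isClosed_closedBall.measurableSet
      _ ≤ _ := by
          gcongr
          rw [← Set.iUnion_inter]
          refine Set.inter_subset_inter_left _ (Set.iUnion_subset fun j => ?_)
          rw [himg]
          exact Set.image_mono (hVφ _ _)

end MIFS

/-! ### Bounds uniform in the starting layer. -/

/-- The limits control a tail; the finitely many other terms are positive reals. The lower bound is
an upper bound for the inverses. -/
theorem exists_bounds_of_liminf_limsup {u : ℕ → ℝ} (hu : ∀ n, 0 < u n)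
    (hinf : 0 < liminf (fun n => (u n : EReal)) atTop)
    (hsup : limsup (fun n => (u n : EReal)) atTop < ⊤) :
    ∃ a b, 0 < a ∧ ∀ n, a ≤ u n ∧ u n ≤ b := by
  obtain ⟨c, hc0, hc⟩ := EReal.lt_iff_exists_real_btwn.1 hinf
  obtain ⟨e, he, -⟩ := EReal.lt_iff_exists_real_btwn.1 hsup
  have hc0 : 0 < c := by exact_mod_cast hc0
  have h1 : BddAbove (Set.range fun n => (u n)⁻¹) := by
    refine IsBoundedUnder.bddAbove_range ⟨c⁻¹, ?_⟩
    rw [eventually_map]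
    filter_upwards [eventually_lt_of_lt_liminf hc] with n hn
    exact inv_anti₀ hc0 (EReal.coe_lt_coe_iff.1 hn).le
  have h2 : BddAbove (Set.range u) := by
    refine IsBoundedUnder.bddAbove_range ⟨e, ?_⟩
    rw [eventually_map]
    filter_upwards [eventually_lt_of_limsup_lt he] with n hn
    exact (EReal.coe_lt_coe_iff.1 hn).le
  obtain ⟨A, hA⟩ := h1
  obtain ⟨b, hb⟩ := h2
  have hA' : ∀ n, (u n)⁻¹ ≤ A := fun n => hA ⟨n, rfl⟩
  have hA0 : 0 < A := (inv_pos.2 (hu 0)).trans_le (hA' 0)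
  exact ⟨A⁻¹, b, inv_pos.2 hA0, fun n => ⟨inv_le_of_inv_le₀ (hu n) (hA' n), hb ⟨n, rfl⟩⟩⟩

namespace MIFS

variable {d : ℕ} {Φ : MIFS d} {r : ∀ n, Fin (Φ.N n) → ℝ}

/-- For `s ≤ 0` every layer sum is at least 2, so the products would grow like `2 ^ n`. -/
theorem pos_of_prod_bounded (h0 : ∀ n j, 0 < r n j) (h1 : ∀ n j, r n j < 1) {s b : ℝ}
    (h : ∀ n, ∏ i ∈ Finset.range n, ∑ j, r i j ^ s ≤ b) : 0 < s := by
  by_contra! hs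
  obtain ⟨n, hn⟩ := pow_unbounded_of_one_lt b one_lt_two
  refine absurd (hn.trans_le ?_) (h n).not_gt
  calc (2 : ℝ) ^ n = ∏ i ∈ Finset.range n, 2 := by simp
    _ ≤ _ := by
      refine Finset.prod_le_prod (fun _ _ => zero_le_two) fun i _ => ?_
      calc (2 : ℝ) ≤ Φ.N i := by exact_mod_cast Φ.two_le_N i
        _ = ∑ j : Fin (Φ.N i), 1 := by simp
        _ ≤ _ := Finset.sum_le_sum fun j _ =>
          Real.one_le_rpow_of_pos_of_le_one_of_nonpos (h0 i j) (h1 i j).le hs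

/-- Disjointness of the images of a nonempty subset forces `X` to have two points. -/
theorem nontrivial_X {V : Set (EuclideanSpace ℝ (Fin d))} (hV : V.Nonempty) (hVX : V ⊆ Φ.X)
    (n : ℕ) (h : ∀ i j, i ≠ j → Disjoint (Φ.φ n i '' V) (Φ.φ n j '' V)) : Φ.X.Nontrivial := by
  obtain ⟨x, hx⟩ := hV
  have hN := Φ.two_le_N n
  let i : Fin (Φ.N n) := ⟨0, by omega⟩
  let j : Fin (Φ.N n) := ⟨1, by omega⟩
  have hij : i ≠ j := by simp [i, j]
  refine ⟨_, Φ.mapsTo n i (hVX hx), _, Φ.mapsTo n j (hVX hx), fun he => ?_⟩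
  exact Set.disjoint_left.1 (h i j hij) ⟨x, hx, rfl⟩ (he ▸ ⟨x, hx, rfl⟩)

variable {O : ∀ n, Fin (Φ.N n) → (EuclideanSpace ℝ (Fin d) ≃ₗᵢ[ℝ] EuclideanSpace ℝ (Fin d))}
  {α : ∀ n, Fin (Φ.N n) → EuclideanSpace ℝ (Fin d)}

/-- Uniform covering and mass bounds for all attractors of a self-similar system that satisfies
the open set condition. -/
theorem IsSelfSimilar.exists_uniform_bounds (hΦ : Φ.IsSelfSimilar r O α) (hV : Φ.MOSC) {ρ : ℝ}
    (hρ0 : 0 < ρ) (hρ : ∀ n j, ρ ≤ r n j) {s a b : ℝ} (hs : 0 < s) (ha : 0 < a)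
    (hab : ∀ n, a ≤ ∏ i ∈ Finset.range n, ∑ j, r i j ^ s ∧
      ∏ i ∈ Finset.range n, ∑ j, r i j ^ s ≤ b) :
    ∃ C₁ C₂ : ℝ, 0 < C₁ ∧ 0 < C₂ ∧ ∀ n,
      (∀ δ : ℝ≥0, 0 < δ → δ < 1 → (Metric.coveringNumber δ (Φ.attractor n) : ℝ≥0∞) ≤
        ENNReal.ofReal (C₁ * (δ : ℝ) ^ (-s))) ∧
      ∃ ν : Measure (EuclideanSpace ℝ (Fin d)), 1 ≤ ν (Φ.attractor n) ∧
        ∀ x, ∀ δ : ℝ, 0 < δ → δ < 1 →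
          ν (Metric.closedBall x δ) ≤ ENNReal.ofReal (C₂ * δ ^ s) := by
  obtain ⟨V, hVo, hVφ, hVd, hVv⟩ := hV
  have hVX : ∀ n, V n ⊆ Φ.X := fun n => by
    obtain ⟨U, -, h⟩ := hVo n
    exact h ▸ Set.inter_subset_right
  have hVm : ∀ n, MeasurableSet (V n) := fun n => by
    obtain ⟨U, hU, h⟩ := hVo n
    exact h ▸ hU.measurableSet.inter Φ.isCompact_X.isClosed.measurableSet
  obtain ⟨v, hv0, hv⟩ := ENNReal.lt_iff_exists_nnreal_btwn.1 hVv
  have hv0 : (0 : ℝ) < v := by exact_mod_cast hv0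
  have hvV : ∀ n, ENNReal.ofReal v ≤ volume (V n) := fun n => by
    rw [ENNReal.ofReal_coe_nnreal]
    exact hv.le.trans (iInf_le _ n)
  have hX : Φ.X.Nontrivial := by
    refine nontrivial_X (V := V 1) ?_ (hVX 1) 0 (hVd 0)
    refine nonempty_of_measure_ne_zero (μ := volume) (ne_of_gt ?_)
    exact (ENNReal.ofReal_pos.2 hv0).trans_le (hvV 1)
  obtain ⟨D', hD1, hD⟩ := Φ.exists_dist_le
  lift D' to ℝ≥0 using zero_le_one.trans hD1
  have hD1' : (1 : ℝ≥0) ≤ D' := by exact_mod_cast hD1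
  have hD0 : (0 : ℝ) < D' := zero_lt_one.trans_le hD1
  have hb : 0 < b := ha.trans_le ((hab 0).1.trans (hab 0).2)
  -- The product over the layers `n, …, n + m - 1` is P_{n+m}/P_n; this makes all constants
  -- independent of `n`.
  have hS : ∀ n m, a / b ≤ ∏ i ∈ Finset.range m, ∑ j, r (n + i) j ^ s ∧
      ∏ i ∈ Finset.range m, ∑ j, r (n + i) j ^ s ≤ b / a := by
    intro n m
    have hn := hab n
    have hnm := hab (n + m)
    rw [Finset.prod_range_add] at hnm
    set p := ∏ i ∈ Finset.range n, ∑ j, r i j ^ s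
    set q := ∏ i ∈ Finset.range m, ∑ j, r (n + i) j ^ s
    have hp : 0 < p := ha.trans_le hn.1
    have hq : 0 < q := pos_of_mul_pos_right (ha.trans_le hnm.1) hp.le
    constructor
    · rw [div_le_iff₀ hb]
      nlinarith
    · rw [le_div_iff₀ ha]
      nlinarith
  obtain ⟨μ, hμ1, hμ⟩ := exists_wordMeasure (Φ := Φ) (fun n j => (hΦ n j).1) s
  have hμup : ∀ n σ m,
      μ (Φ.cylinder n σ m) ≤ ENNReal.ofReal (Φ.ratio r n σ m ^ s / (a / b)) := fun n σ m => by
    rw [hμ]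
    have := hΦ.ratio_pos n σ m
    have := (hS n m).1
    gcongr
  have hμlow : ∀ n σ m,
      ENNReal.ofReal (Φ.ratio r n σ m ^ s / (b / a)) ≤ μ (Φ.cylinder n σ m) := fun n σ m => by
    rw [hμ]
    have := hΦ.ratio_pos n σ m
    have h1 := (hS n m).1
    have h2 := (hS n m).2
    have h3 : 0 < ∏ i ∈ Finset.range m, ∑ j, r (n + i) j ^ s := (by positivity : 0 < a / b).trans_le h1
    gcongr
  -- An arbitrary word: at length 0 it is the root of the tree, with ratio 1, where both estimates
  -- are applied.
  let σ₀ : ∀ i, Fin (Φ.N i) := fun i => ⟨0, two_pos.trans_le (Φ.two_le_N i)⟩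
  have hcyl : ∀ n, Φ.cylinder n σ₀ 0 = Set.univ := fun n => by simp [cylinder]
  have hratio : ∀ n, Φ.ratio r n σ₀ 0 = 1 := fun n => by simp [ratio]
  have hρ1 : ρ < 1 := (hρ 0 (σ₀ 0)).trans_lt (hΦ 0 (σ₀ 0)).2.1
  obtain ⟨ω, hω0, hω⟩ : ∃ ω : ℝ, 0 < ω ∧
      volume (Metric.ball (0 : EuclideanSpace ℝ (Fin d)) 1) = ENNReal.ofReal ω :=
    ⟨_, ENNReal.toReal_pos (Metric.measure_ball_pos _ _ one_pos).ne' measure_ball_lt_top.ne,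
      (ENNReal.ofReal_toReal measure_ball_lt_top.ne).symm⟩
  -- The first constant comes from the scale `δ / D'`, which gives covering radius `δ`. In the
  -- second, `δ ^ d` cancels between the volume of the ball of radius `δ * (1 + D')` and `(ρ * δ) ^
  -- d`.
  refine ⟨b / a * (ρ / D') ^ (-s), (1 + D') ^ d * ω / (a / b * (ρ ^ d * v)), by positivity,
    by positivity, fun n => ⟨fun δ hδ hδ1 => ?_, μ.map (Φ.point n), ?_, fun x δ hδ hδ1 => ?_⟩⟩
  · have hδ' : (0 : ℝ) < δ := hδ
    have hδD : δ / D' ≤ 1 := div_le_one_of_le₀ (hδ1.le.trans hD1') zero_le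
    have h := hΦ.coveringNumber_point_image_cylinder_le hX hD hρ0 hρ (by positivity) hs.le hμlow n
      (δ := δ / D') (by positivity) σ₀ 0 (by
        rw [hratio]
        exact mul_le_one₀ hρ1.le (by positivity) (by exact_mod_cast hδD))
    rw [hcyl, measure_univ, mul_one, Set.image_univ, ← attractor_eq_range_point,
      div_mul_cancel₀ _ (by positivity)] at h
    refine h.trans (le_of_eq ?_)
    rw [mul_assoc, ← Real.mul_rpow (by positivity) hδ'.le, NNReal.coe_div]
    congr 3
    ring
  · calc 1 = μ (Φ.point n ⁻¹' Φ.attractor n) := by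
          rw [attractor_eq_range_point, Set.preimage_range, measure_univ]
      -- This inequality needs no measurability of the attractor.
      _ ≤ _ := Measure.le_map_apply (Φ.measurable_point n).aemeasurable _
  · have h := hΦ.measure_cylinder_inter_preimage_closedBall_le hX hD0.le hD hρ0 hρ
      (by positivity) hv0 hs.le hVX hVm hVφ hVd hvV hμup n x hδ σ₀ 0 (by
        rw [hratio]
        exact mul_le_one₀ hρ1.le hδ.le hδ1.le)
    rw [hcyl, Set.univ_inter] at h
    rw [Measure.map_apply (Φ.measurable_point n) Metric.isClosed_closedBall.measurableSet]
    refine (h.trans (mul_le_mul_right (measure_mono Set.inter_subset_right) _)).trans (le_of_eq ?_)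
    rw [Measure.addHaar_closedBall _ _ (by positivity), hω, finrank_euclideanSpace_fin,
      ← ENNReal.ofReal_mul (by positivity), ← ENNReal.ofReal_mul (by positivity)]
    congr 1
    rw [mul_pow, mul_pow]
    field_simp

end MIFS

/-! ### Hausdorff measure and dimensions of the attractors. -/

theorem theorem4p5 {d : ℕ} (Φ : MIFS d) (r : ∀ n, Fin (Φ.N n) → ℝ)
    (O : ∀ n, Fin (Φ.N n) → (EuclideanSpace ℝ (Fin d) ≃ₗᵢ[ℝ] EuclideanSpace ℝ (Fin d)))
    (α : ∀ n, Fin (Φ.N n) → EuclideanSpace ℝ (Fin d))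
    (hΦ : Φ.IsSelfSimilar r O α) (hV : Φ.MOSC)
    (hr : 0 < ⨅ p : (n : ℕ) × Fin (Φ.N n), r p.1 p.2) (s : ℝ)
    (hinf : 0 < liminf
      (fun n => ((∏ i ∈ Finset.range n, ∑ j, r i j ^ s : ℝ) : EReal)) atTop)
    (hsup : limsup
      (fun n => ((∏ i ∈ Finset.range n, ∑ j, r i j ^ s : ℝ) : EReal)) atTop < ⊤) :
    ((⨆ k, μH[s] (Φ.attractor k)) < ⊤ ∧ 0 < ⨅ k, μH[s] (Φ.attractor k)) ∧
    ∀ n, (dimH (Φ.attractor n) : EReal) = lowerBoxDim (Φ.attractor n) ∧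
      lowerBoxDim (Φ.attractor n) = upperBoxDim (Φ.attractor n) ∧
      upperBoxDim (Φ.attractor n) = (s : EReal) := by
  have hρ : ∀ n j, ⨅ p : (n : ℕ) × Fin (Φ.N n), r p.1 p.2 ≤ r n j := fun n j =>
    ciInf_le (f := fun p : (n : ℕ) × Fin (Φ.N n) => r p.1 p.2)
      ⟨0, by rintro _ ⟨p, rfl⟩; exact (hΦ _ _).1.le⟩ ⟨n, j⟩
  obtain ⟨a, b, ha, hab⟩ := exists_bounds_of_liminf_limsup (fun n =>
    Finset.prod_pos fun i _ => Finset.sum_pos (fun j _ => Real.rpow_pos_of_pos (hΦ i j).1 s)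
      ⟨⟨0, two_pos.trans_le (Φ.two_le_N i)⟩, Finset.mem_univ _⟩) hinf hsup
  have hs : 0 < s := MIFS.pos_of_prod_bounded (fun n j => (hΦ n j).1) (fun n j => (hΦ n j).2.1)
    fun n => (hab n).2
  obtain ⟨C₁, C₂, hC₁, hC₂, hK⟩ := hΦ.exists_uniform_bounds hV hr hρ hs ha hab
  have hup : ∀ n, μH[s] (Φ.attractor n) ≤ ENNReal.ofReal (C₁ * 2 ^ s) := fun n =>
    hausdorffMeasure_le_of_coveringNumber_le hs.le hC₁.le one_pos (hK n).1
  have hlow : ∀ n, (ENNReal.ofReal C₂)⁻¹ ≤ μH[s] (Φ.attractor n) := fun n => by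
    obtain ⟨-, ν, hν1, hν⟩ := hK n
    have h := hν1.trans
      (Measure.le_iff'.1 (measure_le_hausdorffMeasure_of_closedBall_le hs hC₂ one_pos hν) _)
    rw [Measure.smul_apply, smul_eq_mul] at h
    rw [ENNReal.inv_le_iff_le_mul (fun _ => by simpa using hC₂) (fun h => absurd h (by simp))]
    exact h
  have hC₂inv : 0 < (ENNReal.ofReal C₂)⁻¹ := ENNReal.inv_pos.2 ENNReal.ofReal_ne_top
  refine ⟨⟨(iSup_le hup).trans_lt ENNReal.ofReal_lt_top, hC₂inv.trans_le (le_iInf hlow)⟩,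
    fun n => ?_⟩
  have hdim : (dimH (Φ.attractor n) : EReal) = s := by
    have hcoe : ((s.toNNReal : ℝ≥0) : ℝ) = s := Real.coe_toNNReal s hs.le
    have h1 : dimH (Φ.attractor n) = (s.toNNReal : ℝ≥0) :=
      dimH_of_hausdorffMeasure_ne_zero_ne_top (by rw [hcoe]; exact (hC₂inv.trans_le (hlow n)).ne')
        (by rw [hcoe]; exact ((hup n).trans_lt ENNReal.ofReal_lt_top).ne)
    rw [h1, EReal.coe_nnreal_eq_coe_real, hcoe]
  have hbox : Tendsto (boxQuotient (Φ.attractor n)) (𝓝[>] 0) (𝓝 (s : EReal)) := by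
    -- Balls of mass at most `C₂ * δ ^ s` must carry mass at least 1, hence the lower constant
    -- `C₂⁻¹`.
    refine tendsto_boxQuotient (inv_pos.2 hC₂) hC₁ one_pos (fun δ hδ hδ1 => ?_) (hK n).1
    obtain ⟨hcov, ν, hν1, hν⟩ := hK n
    have hδ' : (0 : ℝ) < δ := hδ
    have hfin : Metric.coveringNumber δ (Φ.attractor n) ≠ ⊤ := fun h => by
      simpa [h] using hcov δ hδ hδ1
    have h := hν1.trans (measure_le_coveringNumber_mul
      (fun x => hν x δ hδ' (by exact_mod_cast hδ1)) hfin)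
    rw [Real.rpow_neg hδ'.le, ← mul_inv, ENNReal.ofReal_inv_of_pos (by positivity),
      ENNReal.inv_le_iff_le_mul (fun _ => by simpa using by positivity)
        (fun h => absurd h (by simp)), mul_comm]
    exact h
  rw [hdim, lowerBoxDim, upperBoxDim, hbox.liminf_eq, hbox.limsup_eq]
  exact ⟨rfl, rfl, rfl⟩
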